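/- Let $\mathbf k$ be a commutative ring with unit, $\lambda\in\mathbf k$, $X$ a set and $\Omega$ a semigroup. Algebras are unitary associative $\mathbf k$-algebras, not necessarily commutative. A Rota–Baxter family algebra of weight $\lambda$ is a $\mathbf k$-algebra $R$ with $\mathbf k$-linear operators $(P_\omega)_{\omega\in\Omega}$ on $R$ such that, for all $a,b\in R$ and $\alpha,\beta\in\Omega$, $$P_\alpha(a)P_\beta(b)=P_{\alpha\beta}\big(P_\alpha(a)\,b+a\,P_\beta(b)+\lambda ab\big).$$ A morphism of such algebras is a unital $\mathbf k$-algebra morphism that commutes with the operators of each index $\omega\in\Omega$. Let $\mathcal T=\mathcal T(X,\Omega)$ be the set of (finite) $X$-angularly decorated $\Omega$-typed planar rooted trees. These are defined inductively: a tree $T\in\mathcal T$ consists of a root vertex with $n+1\ge 1$ incoming edges $e_1,\dots,e_{n+1}$, ordered from left to right, and elements $x_1,\dots,x_n\in X$ that decorate the $n$ angles between adjacent edges; each $e_i$ is either a leaf, carrying no decoration, or an internal edge, carrying a type $\alpha_i\in\Omega$ and a tree $T_i\in\mathcal T$ grafted on it. Write $T=[e_1,x_1,e_2,\dots,x_n,e_{n+1}]$,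 and write $|$ for a leaf and $(\alpha,U)$ for an internal edge of type $\alpha$ with the tree $U$ grafted on it. Let $\mathbf k\mathcal T$ be the free $\mathbf k$-module on $\mathcal T$. For $\omega\in\Omega$ let $B^+_\omega:\mathbf k\mathcal T\to\mathbf k\mathcal T$ be the linear map with $B^+_\omega(T)=[(\omega,T)]$ for $T\in\mathcal T$. Let $\diamond$ be the bilinear product on $\mathbf k\mathcal T$ defined on trees $T=[e_1,x_1,\dots,x_m,e_{m+1}]$ and $T'=[e'_1,y_1,\dots,y_n,e'_{n+1}]$ by induction on the sum of their depths, as follows. * If $e_{m+1}=|$, then $T\diamond T'=[e_1,x_1,\dots,x_m,e'_1,y_1,e'_2,\dots,y_n,e'_{n+1}]$. * If $e'_1=|$, then $T\diamond T'=[e_1,x_1,\dots,x_m,e_{m+1},y_1,e'_2,\dots,y_n,e'_{n+1}]$. * If $e_{m+1}=(\alpha,U)$ and $e'_1=(\beta,U')$, then $$T\diamond T'=\Big([e_1,x_1,\dots,x_m,|]\diamond B^+_{\alpha\beta}\big(B^+_\alpha(U)\diamond U'+U\diamond B^+_\beta(U')+\lambda\, U\diamond U'\big)\Big)\diamond[\,|,y_1,e'_2,\dots,y_n,e'_{n+1}].$$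 (The first two rules agree when both apply.) Let $j_X:X\to\mathbf k\mathcal T$, $j_X(x)=[\,|,x,|\,]$. **Theorem.** $(\mathbf k\mathcal T,\diamond,(B^+_\omega)_{\omega\in\Omega})$, together with $j_X$, is the free Rota–Baxter family algebra of weight $\lambda$ on $X$. That is: $(\mathbf k\mathcal T,\diamond)$ is an associative algebra with unit the one-leaf, one-vertex tree $[\,|\,]$, and $(B^+_\omega)_{\omega\in\Omega}$ is a Rota–Baxter family of weight $\lambda$ on it; and for every Rota–Baxter family algebra $(A,(P_\omega)_{\omega\in\Omega})$ of weight $\lambda$ and every map $f:X\to A$ there is a unique morphism of Rota–Baxter family algebras $\bar f:\mathbf k\mathcal T\to A$ with $\bar f\circ j_X=f$. -/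

import Mathlib

universe u v w z

/-- An incoming edge of a vertex of an `Ω`-typed planar rooted tree, together with what is grafted
on it: either a leaf (no vertex above it, no type), or an internal edge with a type `ω : Ω` that
leads to the root vertex of a tree of the type `T`. -/
inductive Branch (Ω : Type v) (T : Type w) : Type (max v w)
  | leaf : Branch Ω T
  | edge (ω : Ω) (t : T) : Branch Ω T

/-- `X`-angularly decorated `Ω`-typed planar rooted trees, with at least one vertex. A tree is
given by the incoming edges `e₁, …, eₙ₊₁` of its root vertex, listed from left to right, `n ≥ 0`,
and the decorations `x₁, …, xₙ` of the `n` angles between adjacent edges: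
`cons e₁ x₁ (cons e₂ x₂ (… (single eₙ₊₁)))`. -/
inductive PlanarTree (X : Type u) (Ω : Type v) : Type (max u v)
  | single (e : Branch Ω (PlanarTree X Ω)) : PlanarTree X Ω
  | cons (e : Branch Ω (PlanarTree X Ω)) (x : X) (rest : PlanarTree X Ω) : PlanarTree X Ω

namespace PlanarTree

variable {X : Type u} {Ω : Type v}

/-- The tree with one vertex and one leaf. -/
def unit : PlanarTree X Ω := single .leaf

/-- The tree with one vertex, two leaves and one angle, decorated by `x`. -/
def corolla (x : X) : PlanarTree X Ω := cons .leaf x (single .leaf)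

/-- Grafting on a new root vertex, through a new internal edge of type `ω`. -/
def graft (ω : Ω) (T : PlanarTree X Ω) : PlanarTree X Ω := single (.edge ω T)

/-- The maximal number of vertices on a path from the root to a leaf. -/
def depth : PlanarTree X Ω → ℕ
  | single .leaf => 1
  | single (.edge _ T) => T.depth + 1
  | cons .leaf _ R => R.depth
  | cons (.edge _ T) _ R => max (T.depth + 1) R.depth

/-- The leftmost incoming edge of the root vertex. -/
def first : PlanarTree X Ω → Branch Ω (PlanarTree X Ω)
  | single e => e
  | cons e _ _ => e

/-- The rightmost incoming edge of the root vertex. -/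
def last : PlanarTree X Ω → Branch Ω (PlanarTree X Ω)
  | single e => e
  | cons _ _ R => R.last

/-- Replace the leftmost incoming edge of the root vertex by `e`. -/
def setFirst (e : Branch Ω (PlanarTree X Ω)) : PlanarTree X Ω → PlanarTree X Ω
  | single _ => single e
  | cons _ x R => cons e x R

/-- For `S` with root edges `a₁, …, aₘ₊₁` and angles `x₁, …, xₘ`, and `T` with root edges
`b₁, …, bₙ₊₁` and angles `y₁, …, yₙ`, this is the tree with root edges
`a₁, …, aₘ, e, b₂, …, bₙ₊₁` and angles `x₁, …, xₘ, y₁, …, yₙ`: the two root vertices are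
identified, and `aₘ₊₁` and `b₁` are replaced by the single edge `e`. -/
def splice (e : Branch Ω (PlanarTree X Ω)) : PlanarTree X Ω → PlanarTree X Ω → PlanarTree X Ω
  | single _, T => T.setFirst e
  | cons a x R, T => cons a x (splice e R T)

theorem one_le_depth : ∀ T : PlanarTree X Ω, 1 ≤ T.depth
  | single .leaf => by simp [depth]
  | single (.edge _ T) => by simp [depth]
  | cons .leaf _ R => by simpa [depth] using one_le_depth R
  | cons (.edge _ T) _ R => by simp [depth]

theorem depth_lt_of_first {ω : Ω} {S : PlanarTree X Ω} :
    ∀ {T : PlanarTree X Ω}, T.first = .edge ω S → S.depth < T.depth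
  | single e, h => by
    obtain rfl : e = .edge ω S := h
    simp [depth]
  | cons e x R, h => by
    obtain rfl : e = .edge ω S := h
    simp [depth]

theorem depth_lt_of_last {ω : Ω} {S : PlanarTree X Ω} :
    ∀ {T : PlanarTree X Ω}, T.last = .edge ω S → S.depth < T.depth
  | single e, h => by
    obtain rfl : e = .edge ω S := h
    simp [depth]
  | cons .leaf x R, h => by
    have := depth_lt_of_last (T := R) h
    simpa [depth] using this
  | cons (.edge _ T) x R, h => by
    have := depth_lt_of_last (T := R) h
    simp [depth, this]

/-- The product `S ⋄ T` of weight `lam` of two trees, an element of the free module on trees.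

If the last root edge of `S` or the first root edge of `T` is a leaf, then the root vertices are
identified and the leaf is absorbed by the other edge. If these two edges are `edge α S'` and
`edge β T'`, then they are replaced by the terms of
`B⁺_α(S') ⋄ B⁺_β(T') = B⁺_{αβ}(B⁺_α(S') ⋄ T' + S' ⋄ B⁺_β(T') + lam • (S' ⋄ T'))`:
for a single tree `U`, `splice (edge (α * β) U) S T` is the tree `(S° ⋄ B⁺_{αβ}(U)) ⋄ °T`, where
`S°` is `S` with its last root edge replaced by a leaf, and `°T` is `T` with its first root edge
replaced by a leaf. -/
noncomputable def mul [Semigroup Ω] {k : Type w} [CommRing k] (lam : k)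
    (S T : PlanarTree X Ω) : PlanarTree X Ω →₀ k :=
  match hS : S.last, hT : T.first with
  | .leaf, e => Finsupp.single (splice e S T) 1
  | .edge α S', .leaf => Finsupp.single (splice (.edge α S') S T) 1
  | .edge α S', .edge β T' =>
    Finsupp.mapDomain (fun U => splice (.edge (α * β) U) S T)
      (mul lam (graft α S') T' + mul lam S' (graft β T') + lam • mul lam S' T')
termination_by S.depth + T.depth
decreasing_by
  all_goals
    have h1 := depth_lt_of_last hS
    have h2 := depth_lt_of_first hT
    try simp only [graft, depth]
    omega

/-- The product `⋄` of weight `lam` on the free `k`-module on trees, by bilinear extension. -/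
noncomputable def diamond [Semigroup Ω] {k : Type w} [CommRing k] (lam : k) :
    (PlanarTree X Ω →₀ k) →ₗ[k] (PlanarTree X Ω →₀ k) →ₗ[k] (PlanarTree X Ω →₀ k) :=
  Finsupp.lift _ k _ fun S => Finsupp.lift _ k _ fun T => mul lam S T

/-- The grafting operator `B⁺_ω`, by linear extension. -/
noncomputable def graftL (k : Type w) [CommRing k] (ω : Ω) :
    (PlanarTree X Ω →₀ k) →ₗ[k] (PlanarTree X Ω →₀ k) :=
  Finsupp.lmapDomain k k (graft ω)

end PlanarTree

/-- `(R, mul, one, P)` is a Rota-Baxter family algebra of weight `lam` over `k`, indexed by `Ω`: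
the bilinear product `mul` makes the `k`-module `R` a unital associative `k`-algebra with unit
`one`, and `P` is a Rota-Baxter family of weight `lam` on it. -/
structure IsRotaBaxterFamilyAlgebra {k : Type w} [CommRing k] {Ω : Type v} [Semigroup Ω] (lam : k)
    {R : Type z} [AddCommGroup R] [Module k R] (mul : R →ₗ[k] R →ₗ[k] R) (one : R)
    (P : Ω → R →ₗ[k] R) : Prop where
  mul_assoc : ∀ a b c : R, mul (mul a b) c = mul a (mul b c)
  one_mul : ∀ a : R, mul one a = a
  mul_one : ∀ a : R, mul a one = a
  rota_baxter : ∀ (α β : Ω) (a b : R),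
    mul (P α a) (P β b) = P (α * β) (mul (P α a) b + mul a (P β b) + lam • mul a b)

/-! The product changes only the last root edge of its left factor and the first root edge of its
right factor. Hence it commutes with joining further edges on the outer sides (`diamond_joinL_left`,
`diamond_joinL_right`), and questions about trees reduce to trees with one root edge: `unit` and
grafts. The tree `unit` is neutral, and on two grafts the recursive rule is exactly the Rota–Baxter
identity (`diamond_graftL_graftL`). Associativity for three grafts follows from that identity and
seven smaller triples (`assoc_of_rotaBaxter`).

For freeness, `eval` reads a tree as the ordered product of its edges and angle decorations; the
same reduction shows that it is multiplicative. Corollas generate all trees under products and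
grafting (`single_cons_eq_diamond`), so the morphism is unique. -/

namespace PlanarTree

/-! ### Joining trees at a new angle. -/

section Product

variable {X : Type u} {Ω : Type v} {k : Type w} [CommRing k]

/-- An induction principle for the free module on trees. -/
theorem free_induction {p : (PlanarTree X Ω →₀ k) → Prop} (a : PlanarTree X Ω →₀ k)
    (zero : p 0) (add : ∀ a b, p a → p b → p (a + b)) (smul : ∀ (c : k) a, p a → p (c • a))
    (tree : ∀ T, p (Finsupp.single T 1)) : p a := by
  induction a using Finsupp.induction_linear with
  | zero => exact zero
  | add f g hf hg => exact add f g hf hg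
  | single T c => simpa using smul c _ (tree T)

/-- Serves termination: passing from `cons e x R` to `single e` lowers the size because the
discarded `R` has positive size. -/
theorem sizeOf_pos (T : PlanarTree X Ω) : 0 < sizeOf T := by
  cases T <;> simp

/-- The tree whose root edges are those of `S` followed by those of `T`, with the new angle
decorated by `x`. -/
def join (x : X) : PlanarTree X Ω → PlanarTree X Ω → PlanarTree X Ω
  | single e, T => cons e x T
  | cons e y R, T => cons e y (join x R T)

@[simp]
theorem first_join (x : X) (S T : PlanarTree X Ω) : (join x S T).first = S.first := by
  cases S <;> rfl

@[simp]
theorem last_join (x : X) : ∀ S T : PlanarTree X Ω, (join x S T).last = T.last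
  | single _, _ => rfl
  | cons _ _ R, T => last_join x R T

theorem setFirst_join (x : X) (e : Branch Ω (PlanarTree X Ω)) (S T : PlanarTree X Ω) :
    (join x S T).setFirst e = join x (S.setFirst e) T := by
  cases S <;> rfl

theorem splice_join_left (x : X) (e : Branch Ω (PlanarTree X Ω)) :
    ∀ S T U : PlanarTree X Ω, splice e (join x S T) U = join x S (splice e T U)
  | single _, _, _ => rfl
  | cons a y R, T, U => congrArg (cons a y) (splice_join_left x e R T U)

theorem splice_join_right (x : X) (e : Branch Ω (PlanarTree X Ω)) :
    ∀ S T U : PlanarTree X Ω, splice e S (join x T U) = join x (splice e S T) U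
  | single _, T, U => setFirst_join x e T U
  | cons a y R, T, U => congrArg (cons a y) (splice_join_right x e R T U)

theorem setFirst_first (T : PlanarTree X Ω) : T.setFirst T.first = T := by
  cases T <;> rfl

theorem splice_last_unit : ∀ S : PlanarTree X Ω, splice S.last S unit = S
  | single _ => rfl
  | cons a x R => congrArg (cons a x) (splice_last_unit R)

/-- The bilinear extension of `join`. -/
noncomputable def joinL (k : Type w) [CommRing k] (x : X) :
    (PlanarTree X Ω →₀ k) →ₗ[k] (PlanarTree X Ω →₀ k) →ₗ[k] (PlanarTree X Ω →₀ k) :=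
  Finsupp.lift _ k _ fun S => Finsupp.lmapDomain k k (join x S)

@[simp]
theorem joinL_single (x : X) (S : PlanarTree X Ω) (a : PlanarTree X Ω →₀ k) :
    joinL k x (Finsupp.single S 1) a = Finsupp.mapDomain (join x S) a := by
  simp [joinL]

theorem joinL_single_right (x : X) (a : PlanarTree X Ω →₀ k) (T : PlanarTree X Ω) :
    joinL k x a (Finsupp.single T 1) = Finsupp.mapDomain (fun S => join x S T) a := by
  induction a using free_induction with
  | zero => simp
  | add a b ha hb => simp [ha, hb, Finsupp.mapDomain_add]
  | smul c a ha => simp [ha, Finsupp.mapDomain_smul]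
  | tree S => simp [Finsupp.mapDomain_single]

@[simp]
theorem graftL_single (ω : Ω) (T : PlanarTree X Ω) :
    graftL k ω (Finsupp.single T 1) = Finsupp.single (graft ω T) 1 := by
  simp [graftL, Finsupp.mapDomain_single]

theorem single_cons (e : Branch Ω (PlanarTree X Ω)) (x : X) (R : PlanarTree X Ω) :
    Finsupp.single (cons e x R) (1 : k) =
      joinL k x (Finsupp.single (single e) 1) (Finsupp.single R 1) := by
  simp [Finsupp.mapDomain_single, join]

/-! ### The product: unit laws and Rota–Baxter identity. -/

variable [Semigroup Ω] (lam : k)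

@[simp]
theorem diamond_single (S T : PlanarTree X Ω) :
    diamond lam (Finsupp.single S 1) (Finsupp.single T 1) = mul lam S T := by
  simp [diamond]

/-- The linear combination of edges by which the product of two trees replaces the last edge
of the left factor and the first edge of the right factor. -/
noncomputable def branchMul :
    Branch Ω (PlanarTree X Ω) → Branch Ω (PlanarTree X Ω) → (Branch Ω (PlanarTree X Ω) →₀ k)
  | .leaf, e => Finsupp.single e 1
  | .edge α S, .leaf => Finsupp.single (.edge α S) 1
  | .edge α S, .edge β T => Finsupp.mapDomain (Branch.edge (α * β))
      (mul lam (graft α S) T + mul lam S (graft β T) + lam • mul lam S T)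

/-- Separates the two edges that interact (`branchMul`) from the surrounding edges (`splice`), which
are carried along unchanged. -/
theorem mul_eq_mapDomain_branchMul (S T : PlanarTree X Ω) :
    mul lam S T = Finsupp.mapDomain (fun e => splice e S T) (branchMul lam S.last T.first) := by
  rw [mul]
  split
  next hS => rw [hS, branchMul, Finsupp.mapDomain_single]
  next hS hT => rw [hS, hT, branchMul, Finsupp.mapDomain_single]
  next hS hT =>
    rw [hS, hT, branchMul, ← Finsupp.mapDomain_comp]
    rfl

/-- The joined tree has the same last root edge as `T`, so the same edges interact and only the
context grows. -/
theorem mul_join_left (x : X) (S T U : PlanarTree X Ω) :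
    mul lam (join x S T) U = Finsupp.mapDomain (join x S) (mul lam T U) := by
  rw [mul_eq_mapDomain_branchMul, mul_eq_mapDomain_branchMul lam T, ← Finsupp.mapDomain_comp,
    last_join]
  congr 1
  funext e
  exact splice_join_left x e S T U

theorem mul_join_right (x : X) (S T U : PlanarTree X Ω) :
    mul lam S (join x T U) = Finsupp.mapDomain (fun V => join x V U) (mul lam S T) := by
  rw [mul_eq_mapDomain_branchMul, mul_eq_mapDomain_branchMul lam S T, ← Finsupp.mapDomain_comp,
    first_join]
  congr 1
  funext e
  exact splice_join_right x e S T U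

theorem unit_mul (T : PlanarTree X Ω) : mul lam unit T = Finsupp.single T 1 := by
  rw [mul_eq_mapDomain_branchMul]
  simp [unit, last, branchMul, splice, setFirst_first, Finsupp.mapDomain_single]

theorem mul_unit (S : PlanarTree X Ω) : mul lam S unit = Finsupp.single S 1 := by
  have h : branchMul lam S.last (unit : PlanarTree X Ω).first = Finsupp.single S.last 1 := by
    cases S.last <;> rfl
  rw [mul_eq_mapDomain_branchMul, h, Finsupp.mapDomain_single, splice_last_unit]

/-- With a single root edge on each side there is no context, so splicing an edge returns that edge
alone. -/
theorem mul_graft_graft (α β : Ω) (S T : PlanarTree X Ω) :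
    mul lam (graft α S) (graft β T) = graftL k (α * β)
      (mul lam (graft α S) T + mul lam S (graft β T) + lam • mul lam S T) := by
  rw [mul_eq_mapDomain_branchMul]
  simp only [graft, last, first, branchMul]
  rw [← Finsupp.mapDomain_comp]
  rfl

theorem diamond_joinL_left (x : X) (a b c : PlanarTree X Ω →₀ k) :
    diamond lam (joinL k x a b) c = joinL k x a (diamond lam b c) := by
  induction a using free_induction with
  | zero => simp
  | add a a' ha ha' => simp only [map_add, LinearMap.add_apply, ha, ha']
  | smul r a ha => simp only [map_smul, LinearMap.smul_apply, ha]
  | tree S =>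
    induction b using free_induction with
    | zero => simp
    | add b b' hb hb' => simp only [map_add, LinearMap.add_apply, hb, hb']
    | smul r b hb => simp only [map_smul, LinearMap.smul_apply, hb]
    | tree T =>
      induction c using free_induction with
      | zero => simp
      | add c c' hc hc' => simp only [map_add, hc, hc']
      | smul r c hc => simp only [map_smul, hc]
      | tree U => simp [Finsupp.mapDomain_single, mul_join_left]

theorem diamond_joinL_right (x : X) (a b c : PlanarTree X Ω →₀ k) :
    diamond lam a (joinL k x b c) = joinL k x (diamond lam a b) c := by
  induction a using free_induction with
  | zero => simp
  | add a a' ha ha' => simp only [map_add, LinearMap.add_apply, ha, ha']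
  | smul r a ha => simp only [map_smul, LinearMap.smul_apply, ha]
  | tree S =>
    induction b using free_induction with
    | zero => simp
    | add b b' hb hb' => simp only [map_add, LinearMap.add_apply, hb, hb']
    | smul r b hb => simp only [map_smul, LinearMap.smul_apply, hb]
    | tree T =>
      induction c using free_induction with
      | zero => simp
      | add c c' hc hc' => simp only [map_add, hc, hc']
      | smul r c hc => simp only [map_smul, hc]
      | tree U =>
        simp [Finsupp.mapDomain_single, mul_join_right, joinL_single_right]

theorem unit_diamond (a : PlanarTree X Ω →₀ k) :
    diamond lam (Finsupp.single unit 1) a = a := by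
  induction a using free_induction with
  | zero => simp
  | add a a' ha ha' => rw [map_add, ha, ha']
  | smul r a ha => rw [map_smul, ha]
  | tree S => rw [diamond_single, unit_mul]

theorem diamond_unit (a : PlanarTree X Ω →₀ k) :
    diamond lam a (Finsupp.single unit 1) = a := by
  induction a using free_induction with
  | zero => simp
  | add a a' ha ha' => rw [map_add, LinearMap.add_apply, ha, ha']
  | smul r a ha => rw [map_smul, LinearMap.smul_apply, ha]
  | tree S => rw [diamond_single, mul_unit]

theorem diamond_graftL_graftL (α β : Ω) (a b : PlanarTree X Ω →₀ k) :
    diamond lam (graftL k α a) (graftL k β b) = graftL k (α * β)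
      (diamond lam (graftL k α a) b + diamond lam a (graftL k β b) + lam • diamond lam a b) := by
  induction a using free_induction with
  | zero => simp
  | add a a' ha ha' =>
    simp only [map_add, map_smul, LinearMap.add_apply, smul_add] at ha ha' ⊢
    rw [ha, ha']
    abel
  | smul r a ha =>
    simp only [map_add, map_smul, LinearMap.smul_apply] at ha ⊢
    rw [ha, smul_add, smul_add, smul_comm lam r]
  | tree S =>
    induction b using free_induction with
    | zero => simp
    | add b b' hb hb' =>
      simp only [map_add, map_smul, smul_add] at hb hb' ⊢
      rw [hb, hb']
      abel
    | smul r b hb =>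
      simp only [map_add, map_smul] at hb ⊢
      rw [hb, smul_add, smul_add, smul_comm lam r]
    | tree T => simp only [graftL_single, diamond_single, mul_graft_graft]

/-! ### Associativity. -/

/-- If the Rota-Baxter family identity holds for a bilinear product, then associativity for three
elements in the images of the operators follows from associativity for simpler triples. -/
theorem assoc_of_rotaBaxter {M : Type*} [AddCommGroup M] [Module k M]
    (m : M →ₗ[k] M →ₗ[k] M) (P : Ω → M →ₗ[k] M)
    (h : ∀ α β a b, m (P α a) (P β b) = P (α * β) (m (P α a) b + m a (P β b) + lam • m a b))
    (α β γ : Ω) (a b c : M)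
    (h₁ : m (m (P α a) (P β b)) c = m (P α a) (m (P β b) c))
    (h₂ : m (m (P α a) b) (P γ c) = m (P α a) (m b (P γ c)))
    (h₃ : m (m a (P β b)) (P γ c) = m a (m (P β b) (P γ c)))
    (h₄ : m (m (P α a) b) c = m (P α a) (m b c))
    (h₅ : m (m a (P β b)) c = m a (m (P β b) c))
    (h₆ : m (m a b) (P γ c) = m a (m b (P γ c)))
    (h₇ : m (m a b) c = m a (m b c)) :
    m (m (P α a) (P β b)) (P γ c) = m (P α a) (m (P β b) (P γ c)) := by
  -- After two expansions, one inner term still contains the expanded `P (α * β)`; folding it back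
  -- into a product gives the left side of `h₁`. On the other side the same device gives the right
  -- side of `h₃`.
  conv_lhs => rw [h α β a b, h, ← h α β a b]
  conv_rhs => rw [h β γ b c, h, ← h β γ b c]
  simp only [map_add, map_smul, LinearMap.add_apply, LinearMap.smul_apply, smul_add,
    h₁, h₂, h₃, h₄, h₅, h₆, h₇, mul_assoc]
  abel

theorem diamond_assoc_tree (S T U : PlanarTree X Ω) :
    diamond lam (diamond lam (Finsupp.single S 1) (Finsupp.single T 1)) (Finsupp.single U 1) =
      diamond lam (Finsupp.single S (1 : k))
        (diamond lam (Finsupp.single T 1) (Finsupp.single U 1)) := by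
  match S, T, U with
  | cons a x R, T, U =>
    rw [single_cons]
    simp only [diamond_joinL_left]
    rw [diamond_assoc_tree R T U]
  -- An angle in the middle factor keeps the two multiplications apart, so both sides agree without
  -- induction.
  | S, cons b y R, U =>
    rw [single_cons]
    simp only [diamond_joinL_left, diamond_joinL_right]
  | S, T, cons c z R =>
    rw [single_cons]
    simp only [diamond_joinL_right]
    rw [diamond_assoc_tree S T (single c)]
  | single .leaf, T, U =>
    exact (congrArg (fun a => diamond lam a _) (unit_diamond lam _)).trans
      (unit_diamond lam _).symm
  | S, single .leaf, U =>
    exact (congrArg (fun a => diamond lam a _) (diamond_unit lam _)).trans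
      (congrArg (diamond lam _) (unit_diamond lam _).symm)
  | S, T, single .leaf =>
    exact (diamond_unit lam _).trans (congrArg (diamond lam _) (diamond_unit lam _).symm)
  -- In each of the seven triples at least one graft is replaced by the tree grafted in it, so the
  -- total size drops.
  | single (.edge α S), single (.edge β T), single (.edge γ U) =>
    have h := assoc_of_rotaBaxter lam (diamond (X := X) lam) (graftL k)
      (diamond_graftL_graftL lam) α β γ (Finsupp.single S 1) (Finsupp.single T 1)
      (Finsupp.single U 1)
    simp only [graftL_single] at h
    exact h (diamond_assoc_tree (graft α S) (graft β T) U)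
      (diamond_assoc_tree (graft α S) T (graft γ U))
      (diamond_assoc_tree S (graft β T) (graft γ U))
      (diamond_assoc_tree (graft α S) T U)
      (diamond_assoc_tree S (graft β T) U)
      (diamond_assoc_tree S T (graft γ U))
      (diamond_assoc_tree S T U)
-- Depth would not do here: removing a root edge can leave it unchanged.
termination_by sizeOf S + sizeOf T + sizeOf U
decreasing_by
  all_goals
    simp [graft, sizeOf_pos]
    try omega

theorem diamond_assoc (a b c : PlanarTree X Ω →₀ k) :
    diamond lam (diamond lam a b) c = diamond lam a (diamond lam b c) := by
  induction a using free_induction with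
  | zero => simp
  | add a a' ha ha' => simp only [map_add, LinearMap.add_apply, ha, ha']
  | smul r a ha => simp only [map_smul, LinearMap.smul_apply, ha]
  | tree S =>
    induction b using free_induction with
    | zero => simp
    | add b b' hb hb' => simp only [map_add, LinearMap.add_apply, hb, hb']
    | smul r b hb => simp only [map_smul, LinearMap.smul_apply, hb]
    | tree T =>
      induction c using free_induction with
      | zero => simp
      | add c c' hc hc' => simp only [map_add, hc, hc']
      | smul r c hc => simp only [map_smul, hc]
      | tree U => exact diamond_assoc_tree lam S T U

theorem isRotaBaxterFamilyAlgebra :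
    IsRotaBaxterFamilyAlgebra lam (diamond (X := X) (Ω := Ω) lam)
      (Finsupp.single unit 1) (graftL k) where
  mul_assoc := diamond_assoc lam
  one_mul := unit_diamond lam
  mul_one := diamond_unit lam
  rota_baxter := diamond_graftL_graftL lam

end Product

/-! ### The universal property. -/

section Universal

variable {X : Type u} {Ω : Type v} {k : Type w} [CommRing k]
  {A : Type z} [Ring A] [Algebra k A] (P : Ω → A →ₗ[k] A) (f : X → A)

/-- The value of a tree in an algebra `A` with operators `P`, for the interpretation `f` of the
angle decorations. -/
def eval : PlanarTree X Ω → A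
  | single .leaf => 1
  | single (.edge ω T) => P ω (eval T)
  | cons .leaf x R => f x * eval R
  | cons (.edge ω T) x R => P ω (eval T) * f x * eval R

theorem eval_cons (e : Branch Ω (PlanarTree X Ω)) (x : X) (R : PlanarTree X Ω) :
    eval P f (cons e x R) = eval P f (single e) * f x * eval P f R := by
  cases e <;> simp [eval]

/-- The linear extension of `eval`. -/
noncomputable def evalL : (PlanarTree X Ω →₀ k) →ₗ[k] A :=
  Finsupp.lift A k _ (eval P f)

@[simp]
theorem evalL_single (T : PlanarTree X Ω) :
    evalL P f (Finsupp.single T 1) = eval P f T := by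
  simp [evalL]

theorem evalL_graftL (ω : Ω) (a : PlanarTree X Ω →₀ k) :
    evalL P f (graftL k ω a) = P ω (evalL P f a) := by
  induction a using free_induction with
  | zero => simp
  | add a b ha hb => simp only [map_add, ha, hb]
  | smul r a ha => simp only [map_smul, ha]
  | tree T => simp [graft, eval]

theorem eval_join (x : X) : ∀ S T : PlanarTree X Ω,
    eval P f (join x S T) = eval P f S * f x * eval P f T
  | single e, T => eval_cons P f e x T
  | cons e y R, T => by
    rw [join, eval_cons, eval_cons, eval_join x R T]
    simp only [mul_assoc]

theorem evalL_joinL (x : X) (a b : PlanarTree X Ω →₀ k) :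
    evalL P f (joinL k x a b) = evalL P f a * f x * evalL P f b := by
  induction a using free_induction with
  | zero => simp
  | add a a' ha ha' => simp only [map_add, LinearMap.add_apply, ha, ha', add_mul]
  | smul r a ha => simp only [map_smul, LinearMap.smul_apply, ha, smul_mul_assoc]
  | tree S =>
    induction b using free_induction with
    | zero => simp
    | add b b' hb hb' => simp only [map_add, hb, hb', mul_add]
    | smul r b hb => simp only [map_smul, hb, mul_smul_comm]
    | tree T => simp [Finsupp.mapDomain_single, eval_join]

variable [Semigroup Ω] {lam : k}

theorem evalL_mul (hP : ∀ α β a b,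
      P α a * P β b = P (α * β) (P α a * b + a * P β b + lam • (a * b)))
    (S T : PlanarTree X Ω) :
    evalL P f (diamond lam (Finsupp.single S 1) (Finsupp.single T 1)) =
      eval P f S * eval P f T := by
  match S, T with
  | cons a x R, T =>
    rw [single_cons, diamond_joinL_left, evalL_joinL, evalL_mul hP R T, eval_cons, evalL_single]
    simp only [mul_assoc]
  | S, cons b y R =>
    rw [single_cons, diamond_joinL_right, evalL_joinL, evalL_mul hP S (single b), eval_cons,
      evalL_single]
    simp only [mul_assoc]
  | single .leaf, T =>
    have h := congrArg (evalL P f) (unit_diamond lam (Finsupp.single T 1))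
    exact h.trans (by simp [eval])
  | S, single .leaf =>
    have h := congrArg (evalL P f) (diamond_unit lam (Finsupp.single S 1))
    exact h.trans (by simp [eval])
  -- The Rota–Baxter identity holds both for trees and in `A`, so the claim reduces to three smaller
  -- products.
  | single (.edge α S), single (.edge β T) =>
    have h := congrArg (evalL P f)
      (diamond_graftL_graftL lam α β (Finsupp.single S 1) (Finsupp.single T 1))
    simp only [graftL_single, evalL_graftL, map_add, map_smul] at h
    rw [evalL_mul hP (graft α S) T, evalL_mul hP S (graft β T), evalL_mul hP S T] at h
    refine h.trans ?_
    simp only [graft, eval]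
    rw [hP, map_add, map_add, map_smul]
termination_by sizeOf S + sizeOf T
decreasing_by
  all_goals
    simp [graft, sizeOf_pos]
    try omega

theorem evalL_diamond (hP : ∀ α β a b,
      P α a * P β b = P (α * β) (P α a * b + a * P β b + lam • (a * b)))
    (a b : PlanarTree X Ω →₀ k) :
    evalL P f (diamond lam a b) = evalL P f a * evalL P f b := by
  induction a using free_induction with
  | zero => simp
  | add a a' ha ha' => simp only [map_add, LinearMap.add_apply, ha, ha', add_mul]
  | smul r a ha => simp only [map_smul, LinearMap.smul_apply, ha, smul_mul_assoc]
  | tree S =>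
    induction b using free_induction with
    | zero => simp
    | add b b' hb hb' => simp only [map_add, hb, hb', mul_add]
    | smul r b hb => simp only [map_smul, hb, mul_smul_comm]
    | tree T => rw [evalL_mul P f hP, evalL_single, evalL_single]

/-- A corolla is two units joined at an angle, so multiplying by it on both sides is joining at that
angle. This determines a morphism on trees with several root edges. -/
theorem single_cons_eq_diamond (e : Branch Ω (PlanarTree X Ω)) (x : X) (R : PlanarTree X Ω) :
    Finsupp.single (cons e x R) (1 : k) =
      diamond lam (Finsupp.single (single e) 1)
        (diamond lam (Finsupp.single (corolla x) 1) (Finsupp.single R 1)) := by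
  have h : Finsupp.single (corolla x) (1 : k) = joinL k x (Finsupp.single unit 1)
      (Finsupp.single (unit : PlanarTree X Ω) 1) := single_cons _ _ _
  rw [h, diamond_joinL_left, unit_diamond, diamond_joinL_right, diamond_unit, single_cons]

theorem morphism_single_eq_eval (φ : (PlanarTree X Ω →₀ k) →ₗ[k] A)
    (hone : φ (Finsupp.single unit 1) = 1)
    (hmul : ∀ a b, φ (diamond lam a b) = φ a * φ b)
    (hgraft : ∀ ω a, φ (graftL k ω a) = P ω (φ a))
    (hcorolla : ∀ x, φ (Finsupp.single (corolla x) 1) = f x) :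
    ∀ T, φ (Finsupp.single T 1) = eval P f T
  | single .leaf => hone
  | single (.edge ω T) => by
    have h := hgraft ω (Finsupp.single T 1)
    rw [graftL_single, morphism_single_eq_eval φ hone hmul hgraft hcorolla T] at h
    exact h
  | cons .leaf x R => by
    rw [single_cons_eq_diamond (lam := lam), hmul, hmul, hcorolla,
      morphism_single_eq_eval φ hone hmul hgraft hcorolla R]
    exact (congrArg (· * _) hone).trans (one_mul _)
  | cons (.edge ω T) x R => by
    have h := hgraft ω (Finsupp.single T 1)
    rw [graftL_single, morphism_single_eq_eval φ hone hmul hgraft hcorolla T] at h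
    rw [single_cons_eq_diamond (lam := lam), hmul, hmul, hcorolla,
      morphism_single_eq_eval φ hone hmul hgraft hcorolla R, eval, mul_assoc]
    exact congrArg (· * _) h

end Universal

end PlanarTree

/-- The free module on `X`-angularly decorated `Ω`-typed planar rooted trees, with the product `⋄`
of weight `lam` and the grafting operators, is the free Rota-Baxter family algebra of weight `lam`
on `X`. -/
theorem theorem2p6 {k : Type w} [CommRing k] (X : Type u) (Ω : Type v) [Semigroup Ω] (lam : k) :
    IsRotaBaxterFamilyAlgebra lam (PlanarTree.diamond (X := X) (Ω := Ω) lam)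
      (Finsupp.single PlanarTree.unit 1) (PlanarTree.graftL k) ∧
    ∀ (A : Type z) [Ring A] [Algebra k A] (P : Ω → A →ₗ[k] A),
      IsRotaBaxterFamilyAlgebra lam (LinearMap.mul k A) 1 P →
      ∀ f : X → A, ∃! φ : (PlanarTree X Ω →₀ k) →ₗ[k] A,
        φ (Finsupp.single PlanarTree.unit 1) = 1 ∧
        (∀ a b, φ (PlanarTree.diamond lam a b) = φ a * φ b) ∧
        (∀ ω a, φ (PlanarTree.graftL k ω a) = P ω (φ a)) ∧
        ∀ x, φ (Finsupp.single (PlanarTree.corolla x) 1) = f x := by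
  refine ⟨PlanarTree.isRotaBaxterFamilyAlgebra lam, fun A _ _ P hA f => ?_⟩
  have hP := hA.rota_baxter
  simp only [LinearMap.mul_apply'] at hP
  refine ⟨PlanarTree.evalL P f, ⟨?_, PlanarTree.evalL_diamond P f hP,
    PlanarTree.evalL_graftL P f, fun x => ?_⟩, ?_⟩
  · simp [PlanarTree.unit, PlanarTree.eval]
  · simp [PlanarTree.corolla, PlanarTree.eval]
  · rintro φ ⟨hone, hmul, hgraft, hcorolla⟩
    ext T
    simpa using PlanarTree.morphism_single_eq_eval P f φ hone hmul hgraft hcorolla T
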